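/- Let $d\ge 0$ and $L\ge 1$ be integers and let $\mathcal L^d=(\mathbb Z/L\mathbb Z)^d$ be the periodic lattice. Let $A:\mathcal L^d\to\mathcal P(\mathcal L^d)$ be a neighborhood such that, for some integer $a\ge 0$, every site has exactly $a$ neighbors and is a neighbor of exactly $a$ sites (as is the case, for instance, for translation-invariant neighborhoods such as those of von Neumann and Moore). Consider the continuous-time open Jackson network with site set $\mathcal L^d$ in which packets enter each site from outside as independent Poisson processes of rate $\lambda>0$, each site is a single-server queue with exponential service of rate $\mu=1$, and a packet served at $\mathbf y$ leaves the network with probability $r_{\mathbf y,\infty}$ and is forwarded to $\mathbf x$ with probability $r_{\mathbf{yx}}\ge 0$, where $\sum_{\mathbf x} r_{\mathbf{yx}}=1-r_{\mathbf y,\infty}$. Assume isotropy, i.e. $r_{\mathbf{yx}}=\frac{1}{|A(\mathbf y)|}(1-r_{\mathbf y,\infty})$ for $\mathbf x\in A(\mathbf y)$ and $r_{\mathbf{yx}}=0$ for $\mathbf x\notin A(\mathbf y)$, and homogeneity, i.e. $r_{\mathbf y,\infty}=r_\infty$ for all $\mathbf y$, with $r_\infty>0$. Write $q(\mathbf x,t)$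 for the queue length (packet in service included) at site $\mathbf x$ and time $t$, so that $(q(\mathbf x,t))_{\mathbf x}$ is a continuous-time Markov chain on $\mathbb N^{\mathcal L^d}$. Then the traffic equations $\sigma(\mathbf x)=\lambda+\sum_{\mathbf y}\sigma(\mathbf y)\,r_{\mathbf{yx}}$, $\mathbf x\in\mathcal L^d$, have exactly one solution, namely $\sigma(\mathbf x)=\sigma=\lambda/r_\infty$ for all $\mathbf x$. Put $\rho=\sigma/\mu=\lambda/r_\infty$. 1. The network converges to a stable state if and only if $\rho<1$: there is a probability law on $\mathbb N^{\mathcal L^d}$ to which the queue lengths converge in law as $t\to\infty$ from every initial law if and only if $\rho<1$; and, for each given initial law, the queue lengths converge in law to some probability law if and only if $\rho<1$. 2. In the stable state, i.e. under any probability law that is the limit in law of the queue lengths for some initial law, the queue length $q(\mathbf x)$ of every site $\mathbf x$ is geometric, $P(q(\mathbf x)=n)=(1-\rho)\rho^n$ for all $n\ge 0$, and has finite expectation $\bar q=\rho/(1-\rho)$. -/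

import Mathlib

open Filter Topology MeasureTheory
open scoped BoundedContinuousFunction

/-- An open Jackson network with site set `V`: external Poisson arrivals of rate `arrivalRate x`
at site `x`, exponential single-server service of rate `serviceRate y` at site `y`, and Markovian
routing: a packet served at `y` is forwarded to `x` with probability `routing y x` and leaves the
network with probability `exitProb y`. -/
structure JacksonNetwork (V : Type*) [Fintype V] where
  arrivalRate : V → ℝ
  serviceRate : V → ℝ
  routing : V → V → ℝ
  exitProb : V → ℝ
  arrivalRate_nonneg : ∀ x, 0 ≤ arrivalRate x
  serviceRate_nonneg : ∀ y, 0 ≤ serviceRate y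
  routing_nonneg : ∀ y x, 0 ≤ routing y x
  exitProb_nonneg : ∀ y, 0 ≤ exitProb y
  sum_routing : ∀ y, ∑ x, routing y x = 1 - exitProb y

/-- The exponential of a bounded operator on a normed space. -/
noncomputable def operatorExp {E : Type*} [NormedAddCommGroup E] [NormedSpace ℝ E]
    (T : E →L[ℝ] E) : E →L[ℝ] E :=
  NormedSpace.exp T

namespace JacksonNetwork

variable {V : Type*} [Fintype V] [DecidableEq V]

/-- The traffic equations for the site traffic `σ`. -/
def TrafficEquations (J : JacksonNetwork V) (σ : V → ℝ) : Prop :=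
  ∀ x, σ x = J.arrivalRate x + ∑ y, σ y * J.routing y x

/-- The infinitesimal generator of the continuous-time Markov chain of queue lengths
`q : V → ℕ`, as an operator on functions of the state: external arrivals, forwardings and
departures. A site serves only when its queue is nonempty. -/
def generatorFun (J : JacksonNetwork V) (f : (V → ℕ) → ℝ) (q : V → ℕ) : ℝ :=
  ∑ x, J.arrivalRate x * (f (q + Pi.single x 1) - f q) +
  ∑ y, if 0 < q y then
      J.serviceRate y *
        (∑ x, J.routing y x * (f (q - Pi.single y 1 + Pi.single x 1) - f q) +
          J.exitProb y * (f (q - Pi.single y 1) - f q))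
    else 0

theorem abs_generatorFun_le (J : JacksonNetwork V) (f : (V → ℕ) →ᵇ ℝ) (q : V → ℕ) :
    |J.generatorFun f q| ≤ (∑ x, 2 * J.arrivalRate x + ∑ y, 2 * J.serviceRate y) * ‖f‖ := by
  have hd : ∀ m : V → ℕ, |f m - f q| ≤ 2 * ‖f‖ := fun m => by
    have h1 := f.norm_coe_le_norm m
    have h2 := f.norm_coe_le_norm q
    rw [Real.norm_eq_abs] at h1 h2
    have h3 := abs_sub (f m) (f q)
    linarith
  have hmul : ∀ (c : ℝ) (m : V → ℕ), 0 ≤ c → |c * (f m - f q)| ≤ c * (2 * ‖f‖) :=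
    fun c m hc => by
      rw [abs_mul, abs_of_nonneg hc]
      exact mul_le_mul_of_nonneg_left (hd m) hc
  unfold generatorFun
  rw [add_mul, Finset.sum_mul, Finset.sum_mul]
  refine (abs_add_le _ _).trans (add_le_add ?_ ?_)
  · refine (Finset.abs_sum_le_sum_abs _ _).trans (Finset.sum_le_sum fun x _ => ?_)
    have := hmul (J.arrivalRate x) (q + Pi.single x 1) (J.arrivalRate_nonneg x)
    linarith
  · refine (Finset.abs_sum_le_sum_abs _ _).trans (Finset.sum_le_sum fun y _ => ?_)
    have hs := J.serviceRate_nonneg y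
    split_ifs with h
    · rw [abs_mul, abs_of_nonneg hs]
      have key : |∑ x, J.routing y x * (f (q - Pi.single y 1 + Pi.single x 1) - f q) +
          J.exitProb y * (f (q - Pi.single y 1) - f q)| ≤ 2 * ‖f‖ := by
        refine (abs_add_le _ _).trans ?_
        have h1 : |∑ x, J.routing y x * (f (q - Pi.single y 1 + Pi.single x 1) - f q)|
            ≤ ∑ x, J.routing y x * (2 * ‖f‖) :=
          (Finset.abs_sum_le_sum_abs _ _).trans
            (Finset.sum_le_sum fun x _ => hmul _ _ (J.routing_nonneg y x))
        rw [← Finset.sum_mul, J.sum_routing y] at h1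
        have h2 := hmul (J.exitProb y) (q - Pi.single y 1) (J.exitProb_nonneg y)
        linarith
      have := mul_le_mul_of_nonneg_left key hs
      linarith
    · rw [abs_zero]
      positivity

theorem generatorFun_add (J : JacksonNetwork V) (f g : (V → ℕ) → ℝ) (q : V → ℕ) :
    J.generatorFun (fun q => f q + g q) q = J.generatorFun f q + J.generatorFun g q := by
  unfold generatorFun
  have e : ∀ a b c d : ℝ, a + b - (c + d) = a - c + (b - d) := fun a b c d => by ring
  have e' : ∀ a b c d : ℝ, a + b + (c + d) = a + c + (b + d) := fun a b c d => by ring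
  conv_rhs => rw [e', ← Finset.sum_add_distrib, ← Finset.sum_add_distrib]
  refine congrArg₂ (fun a b : ℝ => a + b) (Finset.sum_congr rfl fun x _ => ?_) ?_
  · rw [e, mul_add]
  · refine Finset.sum_congr rfl fun y _ => ?_
    split_ifs
    · simp only [e, mul_add, Finset.sum_add_distrib]
      ring
    · rw [add_zero]

theorem generatorFun_smul (J : JacksonNetwork V) (c : ℝ) (f : (V → ℕ) → ℝ) (q : V → ℕ) :
    J.generatorFun (fun q => c * f q) q = c * J.generatorFun f q := by
  unfold generatorFun
  simp only [← mul_sub, mul_left_comm _ c, ← Finset.mul_sum, ← mul_add]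
  rw [mul_add, Finset.mul_sum Finset.univ (fun y => ite _ _ _)]
  congr 1
  refine Finset.sum_congr rfl fun y _ => ?_
  split_ifs
  · rfl
  · rw [mul_zero]

/-- The generator as a bounded operator on the bounded functions of the state (the state space
`V → ℕ` is discrete, so continuity is no restriction). -/
noncomputable def generator (J : JacksonNetwork V) :
    ((V → ℕ) →ᵇ ℝ) →L[ℝ] ((V → ℕ) →ᵇ ℝ) :=
  LinearMap.mkContinuous
    { toFun := fun f => BoundedContinuousFunction.ofNormedAddCommGroupDiscrete
        (J.generatorFun f) _ (J.abs_generatorFun_le f)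
      map_add' := fun f g => by
        ext q
        exact J.generatorFun_add f g q
      map_smul' := fun c f => by
        ext q
        exact J.generatorFun_smul c f q }
    (∑ x, 2 * J.arrivalRate x + ∑ y, 2 * J.serviceRate y)
    (fun f => (BoundedContinuousFunction.norm_le (by
        have h1 := Finset.sum_nonneg fun x (_ : x ∈ Finset.univ) =>
          mul_nonneg zero_le_two (J.arrivalRate_nonneg x)
        have h2 := Finset.sum_nonneg fun y (_ : y ∈ Finset.univ) =>
          mul_nonneg zero_le_two (J.serviceRate_nonneg y)
        positivity)).2
      fun q => J.abs_generatorFun_le f q)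

/-- The transition semigroup `exp (t G)` of the queue-length chain:
`J.semigroup t f q` is the expectation of `f` at time `t` when the chain starts in state `q`. -/
noncomputable def semigroup (J : JacksonNetwork V) (t : ℝ) :
    ((V → ℕ) →ᵇ ℝ) →L[ℝ] ((V → ℕ) →ᵇ ℝ) :=
  operatorExp (t • J.generator)

/-- The expectation of `f` at time `t` when the initial queue lengths have law `ν`. -/
noncomputable def expectation (J : JacksonNetwork V) (ν : Measure (V → ℕ)) (t : ℝ)
    (f : (V → ℕ) →ᵇ ℝ) : ℝ :=
  ∫ q, J.semigroup t f q ∂ν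

/-- The queue lengths, started with law `ν`, converge in law to `π` as time tends to infinity. -/
def ConvergesInLaw (J : JacksonNetwork V) (ν π : Measure (V → ℕ)) : Prop :=
  ∀ f : (V → ℕ) →ᵇ ℝ, Tendsto (fun t : ℝ => J.expectation ν t f) atTop (𝓝 (∫ q, f q ∂π))

/-- The network converges to a stable state: some probability law `π` of the queue lengths is the
limit in law, whatever the initial law. -/
def ConvergesToStableState (J : JacksonNetwork V) : Prop :=
  ∃ π : Measure (V → ℕ), IsProbabilityMeasure π ∧
    ∀ ν : Measure (V → ℕ), IsProbabilityMeasure ν → J.ConvergesInLaw ν π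

/-- Isotropy for the neighborhood `A`: a packet forwarded by `y` goes to each neighbor of `y`
with the same probability, and to no other site. -/
def Isotropic (J : JacksonNetwork V) (A : V → Finset V) : Prop :=
  ∀ y, (∀ x ∈ A y, J.routing y x = 1 / ((A y).card : ℝ) * (1 - J.exitProb y)) ∧
    ∀ x ∉ A y, J.routing y x = 0

end JacksonNetwork

/-- The sites of the periodic `d`-dimensional lattice of width `L`. -/
abbrev LatticeSite (d L : ℕ) : Type := Fin d → ZMod L

/-- The neighborhood `A` is homogeneous with `a` neighbors: every site has exactly `a` neighbors
and is a neighbor of exactly `a` sites. -/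
def IsHomogeneousNeighborhood {V : Type*} [Fintype V] [DecidableEq V]
    (A : V → Finset V) (a : ℕ) : Prop :=
  (∀ y, (A y).card = a) ∧ ∀ x, (Finset.univ.filter fun y => x ∈ A y).card = a

/-! ### Exponentials of power-bounded operators as Poisson averages. -/

section Uniformization

open scoped Nat

/-! Equal in- and out-degrees make the columns of the routing matrix sum to `1 - rInf`, like its
rows, so the constant `ρ = lam / rInf` solves the traffic equations. Positive exit probabilities
make the solution unique in `ℓ¹`.

The generator `G` is bounded. Writing `G = c (K - 1)` with `K` a contraction and `c` the total rate,
the semigroup is a Poisson average of the powers of `K`, whence `‖G exp (tG)‖ = O(1/√t)`. So every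
limit in law is stationary (`ConvergesInLaw.isStationary`), and every pointwise limit of `exp (tG)
f` is harmonic.

Necessity of `ρ < 1`: under a stationary law the throughputs solve the traffic equations, so `P(q x
> 0) = ρ`, and `P(q x = 0) > 0` since packets can leave. Sufficiency: for `ρ < 1` the product of
geometric laws is stationary (Jackson) and charges every state. This forces bounded harmonic
functions to be constant, and compactness then gives convergence from every initial law
(`IsStationary.tendsto_semigroup`). Uniqueness of limits identifies the marginals. -/

theorem hasSum_natCast_mul_pow_div_factorial {f : ℕ → ℝ} {s S : ℝ}
    (h : HasSum (fun n => f (n + 1) * (s ^ n / n !)) S) :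
    HasSum (fun n => n * f n * (s ^ n / n !)) (s * S) := by
  rw [← hasSum_nat_add_iff' 1]
  simp only [Finset.range_one, Finset.sum_singleton, Nat.cast_zero, zero_mul, sub_zero]
  refine (h.mul_left s).congr_fun fun n => ?_
  rw [Nat.factorial_succ, pow_succ]
  push_cast
  field_simp

/-- The unnormalized form of `E (N/s - 1)² = 1/s` for a Poisson variable `N` of mean `s`. Both
moments come from the identity `E[N f(N)] = s E[f(N + 1)]`. -/
theorem hasSum_sq_sub_one_mul_pow_div_factorial {s : ℝ} (hs : s ≠ 0) :
    HasSum (fun n : ℕ => ((n : ℝ) / s - 1) ^ 2 * (s ^ n / n !)) (Real.exp s / s) := by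
  have h0 : HasSum (fun n : ℕ => s ^ n / n !) (Real.exp s) := by
    rw [Real.exp_eq_exp_ℝ]
    exact NormedSpace.expSeries_div_hasSum_exp s
  have h1 : HasSum (fun n : ℕ => n * 1 * (s ^ n / n !)) (s * Real.exp s) :=
    hasSum_natCast_mul_pow_div_factorial (f := fun _ => 1) (by simpa using h0)
  have h2 : HasSum (fun n : ℕ => n * (n : ℝ) * (s ^ n / n !)) (s * (s * Real.exp s + Real.exp s)) :=
    hasSum_natCast_mul_pow_div_factorial (f := fun n => n)
      ((h1.add h0).congr_fun fun n => by push_cast; ring)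
  have := ((h2.mul_left (s⁻¹ ^ 2)).sub (h1.mul_left (2 * s⁻¹))).add h0
  convert! this using 1
  · ext n
    ring
  · field_simp
    ring

variable {𝔸 : Type*} [NormedRing 𝔸] [NormedAlgebra ℝ 𝔸] [CompleteSpace 𝔸]

theorem hasSum_exp_smul (K : 𝔸) (s : ℝ) :
    HasSum (fun n : ℕ => (s ^ n / n !) • K ^ n) (NormedSpace.exp (s • K)) := by
  refine (NormedSpace.exp_series_hasSum_exp' (𝕂 := ℝ) (s • K)).congr_fun fun n => ?_
  rw [smul_pow, smul_smul]
  congr 1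
  ring

theorem exp_smul_sub_one (K : 𝔸) (s : ℝ) :
    NormedSpace.exp (s • (K - 1)) = Real.exp (-s) • NormedSpace.exp (s • K) := by
  have h : s • (K - 1) = s • K + algebraMap ℝ 𝔸 (-s) := by
    rw [Algebra.algebraMap_eq_smul_one, smul_sub, neg_smul, sub_eq_add_neg]
  let _ : NormedAlgebra ℚ 𝔸 := NormedAlgebra.restrictScalars ℚ ℝ 𝔸
  rw [h, NormedSpace.exp_add_of_commute (Algebra.commutes _ _).symm,
    ← NormedSpace.algebraMap_exp_comm, ← Real.exp_eq_exp_ℝ, Algebra.algebraMap_eq_smul_one,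
    mul_smul_comm, mul_one]

theorem norm_exp_smul_sub_one_le {K : 𝔸} (hK : ∀ n : ℕ, ‖K ^ n‖ ≤ 1) {s : ℝ} (hs : 0 ≤ s) :
    ‖NormedSpace.exp (s • (K - 1))‖ ≤ 1 := by
  have h0 : HasSum (fun n : ℕ => s ^ n / n !) (Real.exp s) := by
    rw [Real.exp_eq_exp_ℝ]
    exact NormedSpace.expSeries_div_hasSum_exp s
  have h : ‖NormedSpace.exp (s • K)‖ ≤ Real.exp s := by
    rw [← (hasSum_exp_smul K s).tsum_eq]
    refine tsum_of_norm_bounded h0 fun n => ?_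
    rw [norm_smul, Real.norm_of_nonneg (by positivity)]
    exact mul_le_of_le_one_right (by positivity) (hK n)
  rw [exp_smul_sub_one, norm_smul, Real.norm_of_nonneg (Real.exp_pos _).le, Real.exp_neg]
  exact inv_mul_le_one_of_le₀ h (Real.exp_pos _).le

/-- Reindexing the series, the coefficient of `K ^ n` is `P(N = n) (n/s - 1)` with `N` Poisson of
mean `s`. The norm is therefore at most `E |N/s - 1|`, which the variance bounds by `1/√s`. No
aperiodicity or spectral gap of `K` is involved. -/
theorem norm_sub_one_mul_exp_smul_sub_one_le {K : 𝔸} (hK : ∀ n : ℕ, ‖K ^ n‖ ≤ 1) {s : ℝ}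
    (hs : 0 < s) : ‖(K - 1) * NormedSpace.exp (s • (K - 1))‖ ≤ 1 / √s := by
  have h0 : HasSum (fun n : ℕ => s ^ n / n !) (Real.exp s) := by
    rw [Real.exp_eq_exp_ℝ]
    exact NormedSpace.expSeries_div_hasSum_exp s
  have hr : 0 < √s := Real.sqrt_pos.2 hs
  have hrs : √s ^ 2 = s := Real.sq_sqrt hs.le
  have hshift : HasSum (fun n : ℕ => ((n : ℝ) / s * (s ^ n / n !)) • K ^ n)
      (K * NormedSpace.exp (s • K)) := by
    rw [← hasSum_nat_add_iff' 1]
    simp only [Finset.range_one, Finset.sum_singleton, Nat.cast_zero, zero_div, zero_mul, zero_smul,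
      sub_zero]
    refine ((hasSum_exp_smul K s).mul_left K).congr_fun fun n => ?_
    rw [mul_smul_comm, ← pow_succ', Nat.factorial_succ, pow_succ s]
    congr 1
    push_cast
    field_simp
  have hdiff := hshift.sub (hasSum_exp_smul K s)
  -- In place of Cauchy–Schwarz, the termwise bound `|b| ≤ 1/(2√s) + (√s/2) b²`; the weights make
  -- both halves contribute equally once `E b² = 1/s`.
  have hbound : HasSum (fun n : ℕ => ((√s)⁻¹ / 2 + √s / 2 * ((n : ℝ) / s - 1) ^ 2) * (s ^ n / n !))
      (Real.exp s * (1 / √s)) := by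
    have := (h0.mul_left ((√s)⁻¹ / 2)).add
      ((hasSum_sq_sub_one_mul_pow_div_factorial hs.ne').mul_left (√s / 2))
    convert! this using 1
    · ext n
      ring
    · rw [← hrs, Real.sqrt_sq hr.le]
      field_simp
      norm_num
  have h : ‖(K - 1) * NormedSpace.exp (s • K)‖ ≤ Real.exp s * (1 / √s) := by
    rw [sub_mul, one_mul, ← hdiff.tsum_eq]
    refine tsum_of_norm_bounded hbound fun n => ?_
    rw [← sub_smul, ← sub_one_mul, norm_smul, norm_mul, Real.norm_of_nonneg (r := s ^ n / n !)
      (by positivity)]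
    refine (mul_le_of_le_one_right (by positivity) (hK n)).trans ?_
    refine mul_le_mul_of_nonneg_right ?_ (by positivity)
    rw [Real.norm_eq_abs, ← sq_abs ((n : ℝ) / s - 1)]
    set b := |(n : ℝ) / s - 1|
    have h2 : (√s)⁻¹ / 2 + √s / 2 * b ^ 2 - b = (√s)⁻¹ / 2 * (1 - √s * b) ^ 2 := by
      field_simp
      ring
    have h3 : 0 ≤ (√s)⁻¹ / 2 * (1 - √s * b) ^ 2 := by positivity
    linarith
  rw [exp_smul_sub_one, mul_smul_comm, norm_smul, Real.norm_of_nonneg (Real.exp_pos _).le,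
    Real.exp_neg]
  exact (inv_mul_le_iff₀ (Real.exp_pos _)).2 h

variable {E : Type*} [NormedAddCommGroup E] [NormedSpace ℝ E]

theorem norm_one_add_inv_smul_pow_le {T : E →L[ℝ] E} {c : ℝ} (hc : 0 < c)
    (hT : ∀ f, ‖c • f + T f‖ ≤ c * ‖f‖) (n : ℕ) : ‖(1 + c⁻¹ • T) ^ n‖ ≤ 1 := by
  have h1 : ∀ f, ‖(1 + c⁻¹ • T) f‖ ≤ ‖f‖ := fun f => by
    have e : (1 + c⁻¹ • T) f = c⁻¹ • (c • f + T f) := by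
      rw [smul_add, inv_smul_smul₀ hc.ne']
      rfl
    rw [e, norm_smul, norm_inv, Real.norm_of_nonneg hc.le, inv_mul_le_iff₀ hc]
    exact hT f
  refine ContinuousLinearMap.opNorm_le_bound _ zero_le_one fun f => ?_
  rw [one_mul]
  induction n with
  | zero => simp
  | succ n ih =>
    rw [pow_succ']
    exact (h1 _).trans ih

theorem operatorExp_smul_eq {T : E →L[ℝ] E} {c : ℝ} (hc : 0 < c) (t : ℝ) :
    operatorExp (t • T) = NormedSpace.exp ((t * c) • ((1 + c⁻¹ • T) - 1)) := by
  rw [add_sub_cancel_left, mul_smul, smul_inv_smul₀ hc.ne']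
  rfl

theorem apply_operatorExp_smul_apply (T : E →L[ℝ] E) (t : ℝ) (f : E) :
    T (operatorExp (t • T) f) = operatorExp (t • T) (T f) := by
  have h : Commute T (t • T) := (Commute.refl _).smul_right t
  exact DFunLike.congr_fun h.exp_right.eq f

variable [CompleteSpace E]

theorem norm_operatorExp_smul_apply_le {T : E →L[ℝ] E} {c : ℝ} (hc : 0 < c)
    (hT : ∀ f, ‖c • f + T f‖ ≤ c * ‖f‖) {t : ℝ} (ht : 0 ≤ t) (f : E) :
    ‖operatorExp (t • T) f‖ ≤ ‖f‖ := by
  refine (ContinuousLinearMap.le_of_opNorm_le _ ?_ f).trans_eq (one_mul _)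
  rw [operatorExp_smul_eq hc]
  exact norm_exp_smul_sub_one_le (norm_one_add_inv_smul_pow_le hc hT) (by positivity)

theorem tendsto_norm_apply_operatorExp_smul {T : E →L[ℝ] E} {c : ℝ} (hc : 0 < c)
    (hT : ∀ f, ‖c • f + T f‖ ≤ c * ‖f‖) (f : E) :
    Tendsto (fun t : ℝ => ‖T (operatorExp (t • T) f)‖) atTop (𝓝 0) := by
  have hlim : Tendsto (fun t : ℝ => c * (1 / √(t * c)) * ‖f‖) atTop (𝓝 (c * 0 * ‖f‖)) := by
    refine Tendsto.mul_const _ (Tendsto.const_mul _ ?_)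
    simp only [one_div]
    exact (Real.tendsto_sqrt_atTop.comp (tendsto_id.atTop_mul_const hc)).inv_tendsto_atTop
  rw [mul_zero, zero_mul] at hlim
  refine tendsto_of_tendsto_of_tendsto_of_le_of_le' tendsto_const_nhds hlim
    (Eventually.of_forall fun t => norm_nonneg _) ?_
  filter_upwards [eventually_gt_atTop 0] with t ht
  have e : T = c • ((1 + c⁻¹ • T) - 1) := by
    rw [add_sub_cancel_left, smul_inv_smul₀ hc.ne']
  have h : ‖T * operatorExp (t • T)‖ ≤ c * (1 / √(t * c)) := by
    rw [operatorExp_smul_eq hc]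
    nth_rw 1 [e]
    rw [smul_mul_assoc, norm_smul, Real.norm_of_nonneg hc.le]
    exact mul_le_mul_of_nonneg_left
      (norm_sub_one_mul_exp_smul_sub_one_le (norm_one_add_inv_smul_pow_le hc hT) (by positivity))
      hc.le
  exact ContinuousLinearMap.le_of_opNorm_le _ h f

/-- The functional kills every term of the exponential series except the zeroth. -/
theorem map_operatorExp_smul_apply {T : E →L[ℝ] E} {l : E →L[ℝ] ℝ} (hl : ∀ f, l (T f) = 0)
    (t : ℝ) (f : E) : l (operatorExp (t • T) f) = l f := by
  have h := ((hasSum_exp_smul T t).mapL (ContinuousLinearMap.apply ℝ E f)).mapL l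
  refine h.unique ?_
  convert! hasSum_single (f := fun n : ℕ => l ((t ^ n / n ! : ℝ) • (T ^ n) f)) 0 ?_ using 1
  · simp
  · intro n hn
    obtain ⟨n, rfl⟩ := Nat.exists_eq_succ_of_ne_zero hn
    rw [map_smul, pow_succ' T, mul_apply_eq_comp, hl, smul_zero]

end Uniformization

/-! ### Stationary laws, harmonic functions and convergence of the semigroup. -/

namespace JacksonNetwork

section General

variable {V : Type*} [Fintype V]

/-- The total rate of the events of the network. -/
def totalRate (J : JacksonNetwork V) : ℝ := ∑ x, J.arrivalRate x + ∑ y, J.serviceRate y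

theorem totalRate_nonneg (J : JacksonNetwork V) : 0 ≤ J.totalRate :=
  add_nonneg (Finset.sum_nonneg fun x _ => J.arrivalRate_nonneg x)
    (Finset.sum_nonneg fun y _ => J.serviceRate_nonneg y)

theorem abs_service_term_le (J : JacksonNetwork V) (y : V) {g : V → ℝ} {b M : ℝ}
    (hg : ∀ x, |g x| ≤ M) (hb : |b| ≤ M) :
    |∑ x, J.routing y x * g x + J.exitProb y * b| ≤ M := by
  have h1 : |∑ x, J.routing y x * g x| ≤ (1 - J.exitProb y) * M := by
    rw [← J.sum_routing y, Finset.sum_mul]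
    refine (Finset.abs_sum_le_sum_abs _ _).trans (Finset.sum_le_sum fun x _ => ?_)
    rw [abs_mul, abs_of_nonneg (J.routing_nonneg y x)]
    exact mul_le_mul_of_nonneg_left (hg x) (J.routing_nonneg y x)
  have h2 : |J.exitProb y * b| ≤ J.exitProb y * M := by
    rw [abs_mul, abs_of_nonneg (J.exitProb_nonneg y)]
    exact mul_le_mul_of_nonneg_left hb (J.exitProb_nonneg y)
  refine (abs_add_le _ _).trans ?_
  linarith

variable [DecidableEq V]

theorem generator_apply (J : JacksonNetwork V) (f : (V → ℕ) →ᵇ ℝ) (q : V → ℕ) :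
    J.generator f q = J.generatorFun f q := rfl

/-- Uniformization: adding the total rate to the generator leaves a nonnegative combination of
values of `f`. -/
theorem abs_totalRate_mul_add_generatorFun_le (J : JacksonNetwork V) {f : (V → ℕ) → ℝ} {M : ℝ}
    (hf : ∀ q, |f q| ≤ M) (q : V → ℕ) :
    |J.totalRate * f q + J.generatorFun f q| ≤ J.totalRate * M := by
  have e : J.totalRate * f q + J.generatorFun f q =
      ∑ x, J.arrivalRate x * f (q + Pi.single x 1) +
      ∑ y, J.serviceRate y * if 0 < q y then
        ∑ x, J.routing y x * f (q - Pi.single y 1 + Pi.single x 1) +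
          J.exitProb y * f (q - Pi.single y 1) else f q := by
    unfold generatorFun totalRate
    rw [add_mul, Finset.sum_mul, Finset.sum_mul, add_add_add_comm, ← Finset.sum_add_distrib,
      ← Finset.sum_add_distrib]
    congr 1
    · exact Finset.sum_congr rfl fun x _ => by ring
    · refine Finset.sum_congr rfl fun y _ => ?_
      split_ifs
      · simp only [mul_sub, Finset.sum_sub_distrib, ← Finset.sum_mul, J.sum_routing y]
        ring
      · ring
  rw [e, totalRate, add_mul, Finset.sum_mul, Finset.sum_mul]
  refine (abs_add_le _ _).trans (add_le_add ?_ ?_)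
  · refine (Finset.abs_sum_le_sum_abs _ _).trans (Finset.sum_le_sum fun x _ => ?_)
    rw [abs_mul, abs_of_nonneg (J.arrivalRate_nonneg x)]
    exact mul_le_mul_of_nonneg_left (hf _) (J.arrivalRate_nonneg x)
  · refine (Finset.abs_sum_le_sum_abs _ _).trans (Finset.sum_le_sum fun y _ => ?_)
    rw [abs_mul, abs_of_nonneg (J.serviceRate_nonneg y)]
    refine mul_le_mul_of_nonneg_left ?_ (J.serviceRate_nonneg y)
    split_ifs
    · exact J.abs_service_term_le y (fun x => hf _) (hf _)
    · exact hf q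

theorem abs_generatorFun_le_of_increments (J : JacksonNetwork V) {f : (V → ℕ) → ℝ} {q : V → ℕ}
    {D : ℝ} (hD : 0 ≤ D) (harr : ∀ x, |f (q + Pi.single x 1) - f q| ≤ D)
    (hfwd : ∀ y x, 0 < q y → |f (q - Pi.single y 1 + Pi.single x 1) - f q| ≤ D)
    (hexit : ∀ y, 0 < q y → |f (q - Pi.single y 1) - f q| ≤ D) :
    |J.generatorFun f q| ≤ J.totalRate * D := by
  unfold generatorFun totalRate
  rw [add_mul, Finset.sum_mul, Finset.sum_mul]
  refine (abs_add_le _ _).trans (add_le_add ?_ ?_)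
  · refine (Finset.abs_sum_le_sum_abs _ _).trans (Finset.sum_le_sum fun x _ => ?_)
    rw [abs_mul, abs_of_nonneg (J.arrivalRate_nonneg x)]
    exact mul_le_mul_of_nonneg_left (harr _) (J.arrivalRate_nonneg x)
  · refine (Finset.abs_sum_le_sum_abs _ _).trans (Finset.sum_le_sum fun y _ => ?_)
    have hs := J.serviceRate_nonneg y
    split_ifs with hy
    · rw [abs_mul, abs_of_nonneg hs]
      exact mul_le_mul_of_nonneg_left
        (J.abs_service_term_le y (fun x => hfwd y x hy) (hexit y hy)) hs
    · rw [abs_zero]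
      positivity

theorem norm_totalRate_smul_add_generator_le (J : JacksonNetwork V) (f : (V → ℕ) →ᵇ ℝ) :
    ‖J.totalRate • f + J.generator f‖ ≤ J.totalRate * ‖f‖ :=
  (BoundedContinuousFunction.norm_le (mul_nonneg J.totalRate_nonneg (norm_nonneg f))).2
    (J.abs_totalRate_mul_add_generatorFun_le fun q => f.norm_coe_le_norm q)

theorem norm_semigroup_apply_le (J : JacksonNetwork V) (h : 0 < J.totalRate) {t : ℝ} (ht : 0 ≤ t)
    (f : (V → ℕ) →ᵇ ℝ) : ‖J.semigroup t f‖ ≤ ‖f‖ :=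
  norm_operatorExp_smul_apply_le h J.norm_totalRate_smul_add_generator_le ht f

theorem generator_semigroup_apply (J : JacksonNetwork V) (t : ℝ) (f : (V → ℕ) →ᵇ ℝ) :
    J.generator (J.semigroup t f) = J.semigroup t (J.generator f) :=
  apply_operatorExp_smul_apply J.generator t f

theorem tendsto_generator_semigroup_apply (J : JacksonNetwork V) (h : 0 < J.totalRate)
    (f : (V → ℕ) →ᵇ ℝ) :
    Tendsto (fun t => ‖J.generator (J.semigroup t f)‖) atTop (𝓝 0) :=
  tendsto_norm_apply_operatorExp_smul h J.norm_totalRate_smul_add_generator_le f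

/-- The law `π` is stationary: the generator has mean zero. -/
def IsStationary (J : JacksonNetwork V) (π : Measure (V → ℕ)) : Prop :=
  ∀ f : (V → ℕ) →ᵇ ℝ, ∫ q, J.generator f q ∂π = 0

/-- Since `G` commutes with the semigroup, the `π`-mean of `G f` is the limit of the `ν`-means of `G
(exp (tG) f)`, which vanishes by the `1/√t` decay. -/
theorem ConvergesInLaw.isStationary {J : JacksonNetwork V} (h : 0 < J.totalRate)
    {ν π : Measure (V → ℕ)} [IsProbabilityMeasure ν] (hc : J.ConvergesInLaw ν π) :
    J.IsStationary π := by
  intro f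
  refine tendsto_nhds_unique (hc (J.generator f)) ?_
  refine squeeze_zero_norm (fun t => ?_) (J.tendsto_generator_semigroup_apply h f)
  rw [expectation, ← J.generator_semigroup_apply]
  exact BoundedContinuousFunction.norm_integral_le_norm _ _

theorem IsStationary.integral_semigroup {J : JacksonNetwork V} {π : Measure (V → ℕ)}
    [IsProbabilityMeasure π] (hπ : J.IsStationary π) (t : ℝ) (f : (V → ℕ) →ᵇ ℝ) :
    ∫ q, J.semigroup t f q ∂π = ∫ q, f q ∂π := by
  let φ : ((V → ℕ) →ᵇ ℝ) →L[ℝ] ℝ := LinearMap.mkContinuous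
    { toFun := fun g => ∫ q, g q ∂π
      map_add' := fun g k => integral_add (g.integrable π) (k.integrable π)
      map_smul' := fun c g => integral_const_mul c g } 1
    fun g => by
      rw [one_mul]
      exact BoundedContinuousFunction.norm_integral_le_norm _ _
  exact map_operatorExp_smul_apply (l := φ) hπ t f

/-- A bounded harmonic function is invariant under arrivals, as the mean of its carré du champ
under a stationary law vanishes. -/
theorem IsStationary.harmonic_add_single {J : JacksonNetwork V} {π : Measure (V → ℕ)}
    [IsProbabilityMeasure π] (hπ : J.IsStationary π) (hpos : ∀ q, π {q} ≠ 0)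
    (harr : ∀ x, 0 < J.arrivalRate x) {g : (V → ℕ) →ᵇ ℝ} (hg : J.generator g = 0) (q : V → ℕ)
    (x : V) : g (q + Pi.single x 1) = g q := by
  have hΓ : ∀ q, ∑ x, J.arrivalRate x * (g (q + Pi.single x 1) - g q) ^ 2 ≤
      J.generator (g * g) q := by
    intro q
    have h0 : J.generatorFun g q = 0 := DFunLike.congr_fun hg q
    -- The identity `G(g²) - 2 g G g = Γ(g)`, a sum of squared increments weighted by the jump
    -- rates; only the arrival part is kept.
    have e : J.generatorFun (g * g : (V → ℕ) →ᵇ ℝ) q - 2 * g q * J.generatorFun g q =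
        ∑ x, J.arrivalRate x * (g (q + Pi.single x 1) - g q) ^ 2 +
        ∑ y, if 0 < q y then J.serviceRate y *
          (∑ x, J.routing y x * (g (q - Pi.single y 1 + Pi.single x 1) - g q) ^ 2 +
            J.exitProb y * (g (q - Pi.single y 1) - g q) ^ 2) else 0 := by
      unfold generatorFun
      simp only [BoundedContinuousFunction.mul_apply]
      rw [mul_add, add_sub_add_comm, Finset.mul_sum, Finset.mul_sum, ← Finset.sum_sub_distrib,
        ← Finset.sum_sub_distrib]
      congr 1
      · exact Finset.sum_congr rfl fun x _ => by ring
      · refine Finset.sum_congr rfl fun y _ => ?_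
        split_ifs
        · rw [mul_left_comm, ← mul_sub, mul_add, add_sub_add_comm, Finset.mul_sum,
            ← Finset.sum_sub_distrib]
          congr 2
          · exact Finset.sum_congr rfl fun x _ => by ring
          · ring
        · ring
    rw [h0, mul_zero, sub_zero] at e
    rw [generator_apply, e, le_add_iff_nonneg_right]
    refine Finset.sum_nonneg fun y _ => ?_
    split_ifs
    · exact mul_nonneg (J.serviceRate_nonneg y) (add_nonneg
        (Finset.sum_nonneg fun x _ => mul_nonneg (J.routing_nonneg y x) (sq_nonneg _))
        (mul_nonneg (J.exitProb_nonneg y) (sq_nonneg _)))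
    · exact le_rfl
  have hterm : ∀ q x, 0 ≤ J.arrivalRate x * (g (q + Pi.single x 1) - g q) ^ 2 := fun q x =>
    mul_nonneg (harr x).le (sq_nonneg _)
  have hae := (integral_eq_zero_iff_of_nonneg
    (fun q => (Finset.sum_nonneg fun x _ => hterm q x).trans (hΓ q))
    ((J.generator (g * g)).integrable π)).1 (hπ (g * g))
  -- Every state has positive mass, so almost everywhere means everywhere.
  have hq : J.generator (g * g) q = 0 := by
    by_contra hne
    exact hpos q (measure_mono_null (Set.singleton_subset_iff.2 hne) (ae_iff.1 hae))
  have hle := (Finset.single_le_sum (fun x _ => hterm q x) (Finset.mem_univ x)).trans (hΓ q)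
  rw [hq] at hle
  have h0 := le_antisymm hle (hterm q x)
  simpa [(harr x).ne', sub_eq_zero] using h0

theorem _root_.eq_apply_zero_of_add_single {α : Type*} {g : (V → ℕ) → α}
    (h : ∀ q x, g (q + Pi.single x 1) = g q) (q : V → ℕ) : g q = g 0 := by
  have hs : ∀ (s : Finset V) (q : V → ℕ), g (∑ x ∈ s, Pi.single x (q x)) = g 0 := by
    intro s q
    induction s using Finset.induction_on with
    | empty => simp
    | insert a s ha ih =>
      rw [Finset.sum_insert ha, ← ih]
      generalize (∑ x ∈ s, Pi.single x (q x) : V → ℕ) = p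
      induction q a with
      | zero => simp
      | succ n ihn => rw [Pi.single_add, add_right_comm, h, ihn]
  rw [← hs Finset.univ q, Finset.univ_sum_single]

/-- The topology is that of pointwise convergence: the generator at `q` reads only finitely many
values of `f`. This lets it pass to limits that are not uniform. -/
theorem continuous_generatorFun (J : JacksonNetwork V) (q : V → ℕ) :
    Continuous fun f : (V → ℕ) → ℝ => J.generatorFun f q := by
  unfold generatorFun
  refine Continuous.add (by fun_prop) (continuous_finsetSum _ fun y _ => ?_)
  split_ifs
  · fun_prop
  · exact continuous_const

theorem IsStationary.tendsto_semigroup {J : JacksonNetwork V} {π : Measure (V → ℕ)}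
    [IsProbabilityMeasure π] (hπ : J.IsStationary π) (h : 0 < J.totalRate)
    (hpos : ∀ q, π {q} ≠ 0) (harr : ∀ x, 0 < J.arrivalRate x) (f : (V → ℕ) →ᵇ ℝ) (q : V → ℕ) :
    Tendsto (fun t => J.semigroup t f q) atTop (𝓝 (∫ q, f q ∂π)) := by
  -- Along any sequence of times, a subsequence converges pointwise by compactness of a product of
  -- intervals. Its limit is harmonic, hence constant, and invariance of `π` with dominated
  -- convergence identifies the constant as the mean of `f`.
  refine tendsto_of_subseq_tendsto fun u hu => ?_
  have hbd : ∀ᶠ n in atTop, ∀ q, ‖J.semigroup (u n) f q‖ ≤ ‖f‖ := by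
    filter_upwards [hu.eventually_ge_atTop 0] with n hn q
    exact ((J.semigroup (u n) f).norm_coe_le_norm q).trans (J.norm_semigroup_apply_le h hn f)
  have hcpt : IsCompact (Set.univ.pi fun _ : V → ℕ => Set.Icc (-‖f‖) ‖f‖) :=
    isCompact_univ_pi fun _ => isCompact_Icc
  obtain ⟨g, hg, ψ, hψ, hlim⟩ := hcpt.tendsto_subseq'
    (x := fun n => (J.semigroup (u n) f : (V → ℕ) → ℝ))
    (hbd.mono fun n hn q _ => abs_le.1 (hn q)).frequently
  have hlim' : ∀ q, Tendsto (fun n => J.semigroup (u (ψ n)) f q) atTop (𝓝 (g q)) :=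
    tendsto_pi_nhds.1 hlim
  have hgb : ∀ q, ‖g q‖ ≤ ‖f‖ := fun q => abs_le.2 (hg q trivial)
  let G : (V → ℕ) →ᵇ ℝ := BoundedContinuousFunction.ofNormedAddCommGroupDiscrete g _ hgb
  have hG : J.generator G = 0 := by
    ext q
    refine tendsto_nhds_unique ((J.continuous_generatorFun q).continuousAt.tendsto.comp hlim) ?_
    refine squeeze_zero_norm (fun n => ?_) ((J.tendsto_generator_semigroup_apply h f).comp
      (hu.comp hψ.tendsto_atTop))
    exact (J.generator (J.semigroup (u (ψ n)) f)).norm_coe_le_norm q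
  have hconst : ∀ q, g q = g 0 := eq_apply_zero_of_add_single fun q x =>
    hπ.harmonic_add_single hpos harr hG q x
  have hint : Tendsto (fun n => ∫ q, J.semigroup (u (ψ n)) f q ∂π) atTop (𝓝 (∫ q, g q ∂π)) :=
    tendsto_integral_filter_of_dominated_convergence (fun _ => ‖f‖)
      (Eventually.of_forall fun n => ((J.semigroup (u (ψ n)) f).integrable π).aestronglyMeasurable)
      ((hψ.tendsto_atTop.eventually hbd).mono fun n hn => Eventually.of_forall hn)
      (integrable_const _) (Eventually.of_forall hlim')
  simp only [hπ.integral_semigroup] at hint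
  have hgint := tendsto_nhds_unique tendsto_const_nhds hint
  refine ⟨ψ, ?_⟩
  have : g q = ∫ q, f q ∂π := by
    rw [hgint]
    simp [hconst]
  rw [← this]
  exact hlim' q

theorem IsStationary.convergesInLaw {J : JacksonNetwork V} {π : Measure (V → ℕ)}
    [IsProbabilityMeasure π] (hπ : J.IsStationary π) (h : 0 < J.totalRate)
    (hpos : ∀ q, π {q} ≠ 0) (harr : ∀ x, 0 < J.arrivalRate x) (ν : Measure (V → ℕ))
    [IsProbabilityMeasure ν] : J.ConvergesInLaw ν π := by
  intro f
  have : Tendsto (fun t => ∫ q, J.semigroup t f q ∂ν) atTop (𝓝 (∫ _, (∫ q, f q ∂π) ∂ν)) := by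
    refine tendsto_integral_filter_of_dominated_convergence (fun _ => ‖f‖)
      (Eventually.of_forall fun t => ((J.semigroup t f).integrable ν).aestronglyMeasurable)
      ?_ (integrable_const _) (Eventually.of_forall (hπ.tendsto_semigroup h hpos harr f))
    filter_upwards [eventually_ge_atTop 0] with t ht
    exact Eventually.of_forall fun q => ((J.semigroup t f).norm_coe_le_norm q).trans
      (J.norm_semigroup_apply_le h ht f)
  simpa [expectation] using this

theorem ConvergesInLaw.unique {J : JacksonNetwork V} {ν π₁ π₂ : Measure (V → ℕ)}
    [IsProbabilityMeasure π₁] [IsProbabilityMeasure π₂] (h₁ : J.ConvergesInLaw ν π₁)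
    (h₂ : J.ConvergesInLaw ν π₂) : π₁ = π₂ :=
  ext_of_forall_integral_eq_of_IsFiniteMeasure fun f => tendsto_nhds_unique (h₁ f) (h₂ f)

end General

end JacksonNetwork

theorem exists_eq_add_single {V : Type*} [DecidableEq V] {q : V → ℕ} {y : V} (hy : 0 < q y) :
    ∃ r : V → ℕ, q = r + Pi.single y 1 := by
  refine ⟨q - Pi.single y 1, (tsub_add_cancel_of_le fun x => ?_).symm⟩
  rw [Pi.single_apply]
  split_ifs with hx
  · rwa [hx]
  · exact Nat.zero_le _

/-! ### Products of geometric laws. -/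

section ProductGeometric

open ProbabilityTheory

variable {V : Type*} [Fintype V]

/-- The product of the geometric laws with success probabilities `p x`. -/
noncomputable def productGeometric (p : V → unitInterval) : Measure (V → ℕ) :=
  Measure.pi fun x => geometricMeasure (p x)

instance (p : V → unitInterval) : IsProbabilityMeasure (productGeometric p) := by
  unfold productGeometric
  infer_instance

theorem productGeometric_singleton {p : V → unitInterval} (hp : ∀ x, p x ≠ 0) (q : V → ℕ) :
    productGeometric p {q} = ∏ x, ENNReal.ofReal ((1 - p x : ℝ) ^ q x * p x) := by
  rw [productGeometric, Measure.pi_singleton]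
  exact Finset.prod_congr rfl fun x _ => geometricMeasure_singleton (hp x) _

theorem productGeometric_singleton_ne_zero {p : V → unitInterval} (hp : ∀ x, p x ≠ 0)
    (hp' : ∀ x, p x ≠ 1) (q : V → ℕ) : productGeometric p {q} ≠ 0 := by
  rw [productGeometric_singleton hp]
  exact Finset.prod_ne_zero_iff.2 fun x _ =>
    (ENNReal.ofReal_pos.2 (geometricMeasure_pos (hp x) (hp' x) _)).ne'

theorem productGeometric_map_eval (p : V → unitInterval) (x : V) :
    (productGeometric p).map (fun q => q x) = geometricMeasure (p x) :=
  (measurePreserving_eval (fun x => geometricMeasure (p x)) x).map_eq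

theorem productGeometric_setOf_eq {p : V → unitInterval} {x : V} (hp : p x ≠ 0) (n : ℕ) :
    productGeometric p {q | q x = n} = ENNReal.ofReal ((1 - p x : ℝ) ^ n * p x) := by
  rw [← geometricMeasure_singleton hp, ← productGeometric_map_eval,
    Measure.map_apply (measurable_pi_apply x) (measurableSet_singleton n)]
  rfl

theorem integrable_natCast_geometricMeasure {p : unitInterval} (hp : p ≠ 0) :
    Integrable (fun n : ℕ => (n : ℝ)) (geometricMeasure p) := by
  have hr : ‖(1 - p : ℝ)‖ < 1 := by
    rw [Real.norm_of_nonneg (sub_nonneg.2 p.2.2)]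
    linarith [unitInterval.coe_pos.2 (unitInterval.pos_iff_ne_zero.2 hp)]
  rw [integrable_geometricMeasure_iff hp]
  refine ((hasSum_coe_mul_geometric_of_norm_lt_one hr).summable.mul_right (p : ℝ)).congr fun n => ?_
  rw [Real.norm_natCast]
  ring

theorem integral_natCast_geometricMeasure {p : unitInterval} (hp : p ≠ 0) :
    ∫ n : ℕ, (n : ℝ) ∂geometricMeasure p = (1 - p : ℝ) / p := by
  have hr : ‖(1 - p : ℝ)‖ < 1 := by
    rw [Real.norm_of_nonneg (sub_nonneg.2 p.2.2)]
    linarith [unitInterval.coe_pos.2 (unitInterval.pos_iff_ne_zero.2 hp)]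
  have hp0 : (p : ℝ) ≠ 0 := unitInterval.coe_ne_zero.2 hp
  rw [integral_geometricMeasure hp]
  refine (((hasSum_coe_mul_geometric_of_norm_lt_one hr).mul_right (p : ℝ)).congr_fun
    fun n => ?_).tsum_eq.trans ?_
  · rw [smul_eq_mul]
    ring
  · rw [sub_sub_cancel]
    field_simp

theorem integrable_eval_productGeometric {p : V → unitInterval} {x : V} (hp : p x ≠ 0) :
    Integrable (fun q : V → ℕ => (q x : ℝ)) (productGeometric p) := by
  have h := integrable_natCast_geometricMeasure hp
  rw [← productGeometric_map_eval] at h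
  exact h.comp_measurable (measurable_pi_apply x)

theorem integral_eval_productGeometric {p : V → unitInterval} {x : V} (hp : p x ≠ 0) :
    ∫ q : V → ℕ, (q x : ℝ) ∂productGeometric p = (1 - p x : ℝ) / p x := by
  rw [← integral_natCast_geometricMeasure hp, ← productGeometric_map_eval,
    integral_map (measurable_pi_apply x).aemeasurable
      Measurable.of_discrete.aestronglyMeasurable]

variable [DecidableEq V]

/-- Memorylessness: given that site `y` is busy, the state is distributed as an unconditioned state
with one packet added at `y`. The factor `1 - p y` is the probability of being busy. -/
theorem productGeometric_restrict_pos {p : V → unitInterval} (hp : ∀ x, p x ≠ 0) (y : V) :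
    (productGeometric p).restrict {q | 0 < q y} =
      ENNReal.ofReal (1 - p y : ℝ) • (productGeometric p).map (· + Pi.single y 1) := by
  refine Measure.ext_of_singleton fun q => ?_
  rw [Measure.restrict_apply (measurableSet_singleton q), Measure.smul_apply,
    Measure.map_apply Measurable.of_discrete (measurableSet_singleton q), smul_eq_mul]
  by_cases hq : 0 < q y
  · obtain ⟨r, rfl⟩ := exists_eq_add_single hq
    have h1 : ({r + Pi.single y 1} : Set (V → ℕ)) ∩ {q | 0 < q y} = {r + Pi.single y 1} :=
      Set.inter_eq_left.2 (Set.singleton_subset_iff.2 hq)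
    have h2 : (fun s : V → ℕ => s + Pi.single y 1) ⁻¹' ({r + Pi.single y 1} : Set (V → ℕ)) = {r} := by
      ext s
      simp
    rw [h1, h2, productGeometric_singleton hp, productGeometric_singleton hp]
    have h3 : ENNReal.ofReal (1 - p y : ℝ) =
        ∏ x, if x = y then ENNReal.ofReal (1 - p x : ℝ) else 1 := by
      simp
    rw [h3, ← Finset.prod_mul_distrib]
    refine Finset.prod_congr rfl fun x _ => ?_
    have hx : (0 : ℝ) ≤ 1 - p x := sub_nonneg.2 (p x).2.2
    split_ifs with hxy
    · subst hxy
      rw [← ENNReal.ofReal_mul hx]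
      congr 1
      simp only [Pi.add_apply, Pi.single_eq_same]
      ring
    · simp [hxy]
  · have h1 : ({q} : Set (V → ℕ)) ∩ {q | 0 < q y} = ∅ := by
      rw [Set.singleton_inter_eq_empty]
      exact hq
    have h2 : (fun s : V → ℕ => s + Pi.single y 1) ⁻¹' ({q} : Set (V → ℕ)) = ∅ := by
      ext s
      simp only [Set.mem_preimage, Set.mem_singleton_iff, Set.mem_empty_iff_false, iff_false]
      rintro rfl
      simp at hq
    rw [h1, h2, measure_empty, mul_zero]

theorem integral_ite_pos_productGeometric {p : V → unitInterval} (hp : ∀ x, p x ≠ 0) (y : V)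
    (g : (V → ℕ) → ℝ) :
    ∫ q, (if 0 < q y then g (q - Pi.single y 1) else 0) ∂productGeometric p =
      (1 - p y : ℝ) * ∫ q, g q ∂productGeometric p := by
  have e : (fun q : V → ℕ => if 0 < q y then g (q - Pi.single y 1) else 0) =
      Set.indicator {q | 0 < q y} fun q => g (q - Pi.single y 1) := by
    ext q
    simp [Set.indicator_apply]
  rw [e, integral_indicator (Set.to_countable _).measurableSet, productGeometric_restrict_pos hp,
    integral_smul_measure, integral_map Measurable.of_discrete.aemeasurable
      Measurable.of_discrete.aestronglyMeasurable,
    ENNReal.toReal_ofReal (sub_nonneg.2 (p y).2.2), smul_eq_mul]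
  simp

end ProductGeometric

/-! ### Jackson's theorem and necessary conditions for stationarity. -/

namespace JacksonNetwork

variable {V : Type*} [Fintype V]

/-- Global balance: summed over the sites, the forwarded traffic cancels. -/
theorem TrafficEquations.sum_exit {J : JacksonNetwork V} {σ : V → ℝ} (hσ : J.TrafficEquations σ) :
    ∑ y, σ y * J.exitProb y = ∑ x, J.arrivalRate x := by
  have h : ∑ x, σ x = ∑ x, J.arrivalRate x + ∑ y, σ y * (1 - J.exitProb y) := by
    rw [Finset.sum_congr rfl fun x _ => hσ x, Finset.sum_add_distrib, Finset.sum_comm]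
    simp only [← Finset.mul_sum, J.sum_routing]
  simp only [mul_sub, mul_one, Finset.sum_sub_distrib] at h
  linarith

variable [DecidableEq V]

/-- **Jackson's theorem**: the product of geometric laws given by a solution of the traffic
equations is stationary. -/
theorem isStationary_productGeometric {J : JacksonNetwork V} {p : V → unitInterval}
    (hp : ∀ x, p x ≠ 0) (hσ : J.TrafficEquations fun x => J.serviceRate x * (1 - p x)) :
    J.IsStationary (productGeometric p) := by
  intro f
  have hi : ∀ k : (V → ℕ) → (V → ℕ), Integrable (fun q => f (k q)) (productGeometric p) := fun k =>
    Integrable.of_bound Measurable.of_discrete.aestronglyMeasurable ‖f‖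
      (Eventually.of_forall fun q => f.norm_coe_le_norm _)
  have hi' : ∀ y (k : (V → ℕ) → (V → ℕ)),
      Integrable (fun q => if 0 < q y then f (k q) else 0) (productGeometric p) := fun y k =>
    Integrable.of_bound Measurable.of_discrete.aestronglyMeasurable ‖f‖
      (Eventually.of_forall fun q => by
        split_ifs
        · exact f.norm_coe_le_norm _
        · simp)
  -- On a busy state `q` is written `q - e_y + e_y`, so that every service term is a function of `q
  -- - e_y` and the memoryless shift applies to all of them.
  have e : ∀ q, J.generator f q =
      ∑ x, J.arrivalRate x * (f (q + Pi.single x 1) - f q) +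
      ∑ y, J.serviceRate y *
        (∑ x, J.routing y x * ((if 0 < q y then f (q - Pi.single y 1 + Pi.single x 1) else 0) -
            if 0 < q y then f (q - Pi.single y 1 + Pi.single y 1) else 0) +
          J.exitProb y * ((if 0 < q y then f (q - Pi.single y 1) else 0) -
            if 0 < q y then f (q - Pi.single y 1 + Pi.single y 1) else 0)) := by
    intro q
    rw [generator_apply, generatorFun]
    congr 1
    refine Finset.sum_congr rfl fun y _ => ?_
    split_ifs with hy
    · obtain ⟨r, rfl⟩ := exists_eq_add_single hy
      rw [add_tsub_cancel_right]
    · simp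
  set F := ∫ q, f q ∂productGeometric p
  set Fx : V → ℝ := fun x => ∫ q, f (q + Pi.single x 1) ∂productGeometric p
  have h1 : ∀ x, ∫ q, J.arrivalRate x * (f (q + Pi.single x 1) - f q) ∂productGeometric p =
      J.arrivalRate x * (Fx x - F) := fun x => by
    rw [integral_const_mul, integral_sub (hi _) (hi _)]
  have h2 : ∀ y x, ∫ q, (if 0 < q y then f (q - Pi.single y 1 + Pi.single x 1) else 0)
      ∂productGeometric p = (1 - p y) * Fx x := fun y x =>
    integral_ite_pos_productGeometric hp y fun q => f (q + Pi.single x 1)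
  have h3 : ∀ y, ∫ q, (if 0 < q y then f (q - Pi.single y 1) else 0)
      ∂productGeometric p = (1 - p y) * F := fun y =>
    integral_ite_pos_productGeometric hp y f
  have hsum : ∀ y, ∫ q, ∑ x, J.routing y x *
      ((if 0 < q y then f (q - Pi.single y 1 + Pi.single x 1) else 0) -
        if 0 < q y then f (q - Pi.single y 1 + Pi.single y 1) else 0) ∂productGeometric p =
      ∑ x, J.routing y x * ((1 - p y) * Fx x - (1 - p y) * Fx y) := fun y => by
    rw [integral_finsetSum]
    · refine Finset.sum_congr rfl fun x _ => ?_
      rw [integral_const_mul, integral_sub (hi' _ _) (hi' _ _), h2, h2]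
    · exact fun x _ => ((hi' _ _).sub (hi' _ _)).const_mul _
  have h4 : ∫ q, J.generator f q ∂productGeometric p =
      ∑ x, J.arrivalRate x * (Fx x - F) + ∑ y, J.serviceRate y *
        (∑ x, J.routing y x * ((1 - p y) * Fx x - (1 - p y) * Fx y) +
          J.exitProb y * ((1 - p y) * F - (1 - p y) * Fx y)) := by
    simp only [e]
    rw [integral_add, integral_finsetSum, integral_finsetSum]
    · congr 1
      · exact Finset.sum_congr rfl fun x _ => h1 x
      · refine Finset.sum_congr rfl fun y _ => ?_
        rw [integral_const_mul, integral_add, hsum, integral_const_mul,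
          integral_sub (hi' _ _) (hi' _ _), h2, h3]
        · exact integrable_finsetSum _ fun x _ => ((hi' _ _).sub (hi' _ _)).const_mul _
        · exact ((hi' _ _).sub (hi' _ _)).const_mul _
    · exact fun y _ => ((integrable_finsetSum _ fun x _ =>
        ((hi' _ _).sub (hi' _ _)).const_mul _).add
          (((hi' _ _).sub (hi' _ _)).const_mul _)).const_mul _
    · exact fun x _ => ((hi _).sub (hi _)).const_mul _
    · exact integrable_finsetSum _ fun x _ => ((hi _).sub (hi _)).const_mul _
    · exact integrable_finsetSum _ fun y _ => ((integrable_finsetSum _ fun x _ =>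
        ((hi' _ _).sub (hi' _ _)).const_mul _).add
          (((hi' _ _).sub (hi' _ _)).const_mul _)).const_mul _
  have h5 : ∑ y, J.serviceRate y *
        (∑ x, J.routing y x * ((1 - p y) * Fx x - (1 - p y) * Fx y) +
          J.exitProb y * ((1 - p y) * F - (1 - p y) * Fx y)) =
      ∑ y, (∑ x, J.serviceRate y * (1 - p y) * J.routing y x * Fx x +
        (J.serviceRate y * (1 - p y) * J.exitProb y * F -
          J.serviceRate y * (1 - p y) * Fx y)) := by
    refine Finset.sum_congr rfl fun y _ => ?_
    simp only [mul_sub (J.routing y _), Finset.sum_sub_distrib]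
    rw [← Finset.sum_mul, J.sum_routing, add_comm (∑ x, _) (_ - _), ← sub_eq_iff_eq_add]
    have : ∀ x, J.serviceRate y * (1 - p y) * J.routing y x * Fx x =
        J.serviceRate y * (J.routing y x * ((1 - p y) * Fx x)) := fun x => by ring
    simp only [this, ← Finset.mul_sum]
    ring
  -- The traffic equations cancel the coefficient of each `Fx x`; the coefficient of `F` cancels by
  -- `sum_exit`.
  have h6 : ∀ x, J.serviceRate x * (1 - p x) * Fx x = J.arrivalRate x * Fx x +
      ∑ y, J.serviceRate y * (1 - p y) * J.routing y x * Fx x := fun x => by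
    rw [← Finset.sum_mul, ← add_mul, ← hσ x]
  rw [h4, h5, Finset.sum_add_distrib, Finset.sum_comm, Finset.sum_sub_distrib, ← Finset.sum_mul,
    hσ.sum_exit]
  rw [Finset.sum_congr rfl fun x _ => h6 x, Finset.sum_add_distrib]
  simp only [mul_sub (J.arrivalRate _), Finset.sum_sub_distrib, ← Finset.sum_mul]
  ring

/-- Under a stationary law, the throughputs solve the traffic equations. -/
theorem IsStationary.trafficEquations {J : JacksonNetwork V} {π : Measure (V → ℕ)}
    [IsProbabilityMeasure π] (hπ : J.IsStationary π) :
    J.TrafficEquations fun y => J.serviceRate y * π.real {q | 0 < q y} := by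
  intro x
  -- The queue length is unbounded and not known to be integrable, so it is truncated at `N`. Its
  -- increments stay at most `1`, so the generator is bounded uniformly in `N` and dominated
  -- convergence applies.
  let f : ℕ → ((V → ℕ) →ᵇ ℝ) := fun N =>
    BoundedContinuousFunction.ofNormedAddCommGroupDiscrete (fun q => ((min (q x) N : ℕ) : ℝ)) N
      fun q => by
        rw [Real.norm_natCast]
        exact_mod_cast min_le_right _ _
  have hlip : ∀ (N : ℕ) (q r : V → ℕ), q x ≤ r x + 1 → r x ≤ q x + 1 → |f N r - f N q| ≤ 1 := by
    intro N q r h1 h2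
    have h3 : min (q x) N ≤ min (r x) N + 1 := by omega
    have h4 : min (r x) N ≤ min (q x) N + 1 := by omega
    have h3' : f N q ≤ f N r + 1 := by
      change ((min (q x) N : ℕ) : ℝ) ≤ ((min (r x) N : ℕ) : ℝ) + 1
      exact_mod_cast h3
    have h4' : f N r ≤ f N q + 1 := by
      change ((min (r x) N : ℕ) : ℝ) ≤ ((min (q x) N : ℕ) : ℝ) + 1
      exact_mod_cast h4
    rw [abs_le]
    constructor <;> linarith
  have hsingle : ∀ y : V, (Pi.single y 1 : V → ℕ) x ≤ 1 := fun y => by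
    rw [Pi.single_apply]
    split_ifs <;> omega
  have hbound : ∀ N q, ‖J.generator (f N) q‖ ≤ J.totalRate * 1 := fun N q => by
    refine J.abs_generatorFun_le_of_increments zero_le_one (fun z => ?_) (fun y z _ => ?_)
      fun y _ => ?_
    · refine hlip N q _ ?_ ?_ <;> have := hsingle z <;> simp only [Pi.add_apply] <;> omega
    · refine hlip N q _ ?_ ?_ <;> have := hsingle z <;> have := hsingle y <;>
        simp only [Pi.add_apply, Pi.sub_apply] <;> omega
    · refine hlip N q _ ?_ ?_ <;> have := hsingle y <;> simp only [Pi.sub_apply] <;> omega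
  have hlim : ∀ q, Tendsto (fun N => J.generator (f N) q) atTop
      (𝓝 (J.generatorFun (fun q => (q x : ℝ)) q)) := fun q => by
    refine ((J.continuous_generatorFun q).tendsto _).comp (tendsto_pi_nhds.2 fun r => ?_)
    refine tendsto_const_nhds.congr' ?_
    filter_upwards [eventually_ge_atTop (r x)] with N hN
    change (r x : ℝ) = ((min (r x) N : ℕ) : ℝ)
    rw [min_eq_left hN]
  have hint : ∫ q, J.generatorFun (fun q => (q x : ℝ)) q ∂π = 0 := by
    refine tendsto_nhds_unique (tendsto_integral_of_dominated_convergence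
      (fun _ => J.totalRate * 1) (fun N => ((J.generator (f N)).integrable π).aestronglyMeasurable)
      (integrable_const _) (fun N => Eventually.of_forall (hbound N))
      (Eventually.of_forall hlim)) ?_
    simp only [hπ (f _)]
    exact tendsto_const_nhds
  have hgen : ∀ q, J.generatorFun (fun q => (q x : ℝ)) q = J.arrivalRate x +
      ∑ y, {q : V → ℕ | 0 < q y}.indicator
        (fun _ => J.serviceRate y * J.routing y x - if y = x then J.serviceRate y else 0) q := by
    intro q
    unfold generatorFun
    congr 1
    · simp [Pi.single_apply]
    · refine Finset.sum_congr rfl fun y _ => ?_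
      simp only [Set.indicator_apply, Set.mem_ofPred_eq]
      by_cases hy : 0 < q y
      · obtain ⟨r, rfl⟩ := exists_eq_add_single hy
        rw [if_pos hy, if_pos hy]
        simp only [add_tsub_cancel_right, Pi.add_apply, Nat.cast_add, add_sub_add_left_eq_sub,
          mul_sub, Finset.sum_sub_distrib, ← Finset.sum_mul, J.sum_routing]
        by_cases hyx : y = x
        · subst hyx
          simp [Pi.single_apply]
          ring
        · simp [Pi.single_apply, hyx, Ne.symm hyx]
      · rw [if_neg hy, if_neg hy]
  simp only [hgen] at hint
  rw [integral_add (integrable_const _) (integrable_finsetSum _ fun y _ =>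
    (integrable_const _).indicator (Set.to_countable _).measurableSet), integral_finsetSum _
    fun y _ => (integrable_const _).indicator (Set.to_countable _).measurableSet] at hint
  simp only [integral_indicator_const _ (Set.to_countable _).measurableSet, integral_const,
    probReal_univ, smul_eq_mul, mul_sub, Finset.sum_sub_distrib, mul_ite, mul_zero,
    Finset.sum_ite_eq', Finset.mem_univ, if_true] at hint
  have e : ∀ y, J.serviceRate y * π.real {q | 0 < q y} * J.routing y x =
    π.real {q | 0 < q y} * (J.serviceRate y * J.routing y x) := fun y => by ring
  simp only [e]
  linarith

/-- Where a nonnegative function vanishes it is minimal, so every jump contributes a nonnegative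
amount and a single exit term can be kept. -/
theorem exit_le_generatorFun (J : JacksonNetwork V) {f : (V → ℕ) → ℝ} (hf : ∀ q, 0 ≤ f q)
    {q : V → ℕ} (hq : f q = 0) {y : V} (hy : 0 < q y) :
    J.serviceRate y * (J.exitProb y * f (q - Pi.single y 1)) ≤ J.generatorFun f q := by
  unfold generatorFun
  simp only [hq, sub_zero]
  have h0 : 0 ≤ ∑ x, J.arrivalRate x * f (q + Pi.single x 1) :=
    Finset.sum_nonneg fun x _ => mul_nonneg (J.arrivalRate_nonneg x) (hf _)
  have hr : ∀ y, 0 ≤ ∑ x, J.routing y x * f (q - Pi.single y 1 + Pi.single x 1) := fun y =>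
    Finset.sum_nonneg fun x _ => mul_nonneg (J.routing_nonneg y x) (hf _)
  refine le_trans ?_ (le_add_of_nonneg_left h0)
  refine le_trans ?_ (Finset.single_le_sum (fun z _ => ?_) (Finset.mem_univ y))
  · rw [if_pos hy]
    exact mul_le_mul_of_nonneg_left (le_add_of_nonneg_left (hr y)) (J.serviceRate_nonneg y)
  · split_ifs
    · exact mul_nonneg (J.serviceRate_nonneg z)
        (add_nonneg (hr z) (mul_nonneg (J.exitProb_nonneg z) (hf _)))
    · exact le_rfl

/-- Under a stationary law, a site that packets can leave is idle with positive probability. -/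
theorem IsStationary.measure_eq_zero_ne_zero {J : JacksonNetwork V} {π : Measure (V → ℕ)}
    [IsProbabilityMeasure π] (hπ : J.IsStationary π) {x : V} (hs : 0 < J.serviceRate x)
    (he : 0 < J.exitProb x) : π {q | q x = 0} ≠ 0 := by
  intro h0
  -- If `q x ≤ n` is null, its indicator vanishes almost surely, yet its generator is at least a
  -- positive multiple of the indicator of `q x = n + 1`. Mean zero makes that event null too; the
  -- union over `n` contradicts total mass one.
  have hn : ∀ n : ℕ, π {q | q x ≤ n} = 0 := by
    intro n
    induction n with
    | zero => simpa using h0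
    | succ n ih =>
      let f : (V → ℕ) →ᵇ ℝ := BoundedContinuousFunction.ofNormedAddCommGroupDiscrete
        (fun q => if q x ≤ n then 1 else 0) 1 fun q => by split_ifs <;> simp
      have hf : ∀ q, f q = if q x ≤ n then 1 else 0 := fun q => rfl
      have hf0 : ∀ q, 0 ≤ f q := fun q => by
        rw [hf]
        split_ifs <;> norm_num
      have hle : ∀ᵐ q ∂π, J.serviceRate x * J.exitProb x *
          {q : V → ℕ | q x = n + 1}.indicator (fun _ => 1) q ≤ J.generator f q := by
        have hae : ∀ᵐ q ∂π, ¬ q x ≤ n := by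
          rw [ae_iff]
          simpa using ih
        filter_upwards [hae] with q hq
        have h := J.exit_le_generatorFun hf0 ((hf q).trans (if_neg hq)) (y := x) (by omega)
        refine le_trans (le_of_eq ?_) h
        rw [mul_assoc, hf]
        congr 2
        simp only [Set.indicator_apply, Set.mem_ofPred_eq, Pi.sub_apply, Pi.single_eq_same]
        exact if_congr (by omega) rfl rfl
      have hint := integral_mono_ae (((integrable_const (1 : ℝ)).indicator
        (Set.to_countable _).measurableSet).const_mul _) ((J.generator f).integrable π) hle
      rw [hπ f, integral_const_mul, integral_indicator_const _ (Set.to_countable _).measurableSet,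
        smul_eq_mul, mul_one] at hint
      have hreal : π.real {q | q x = n + 1} = 0 :=
        le_antisymm (nonpos_of_mul_nonpos_right hint (mul_pos hs he)) measureReal_nonneg
      have hsub : {q : V → ℕ | q x ≤ n + 1} ⊆ {q | q x ≤ n} ∪ {q | q x = n + 1} := fun q hq => by
        simp only [Set.mem_ofPred_eq, Set.mem_union] at hq ⊢
        omega
      exact measure_mono_null hsub (measure_union_null ih ((measureReal_eq_zero_iff).1 hreal))
  have huniv : (⋃ n : ℕ, {q : V → ℕ | q x ≤ n}) = Set.univ :=
    Set.eq_univ_of_forall fun q => Set.mem_iUnion.2 ⟨q x, Set.mem_ofPred.2 le_rfl⟩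
  have := measure_iUnion_null hn
  rw [huniv, measure_univ] at this
  exact one_ne_zero this

end JacksonNetwork

/-! ### Solving the traffic equations. -/

namespace JacksonNetwork

variable {V : Type*} [Fintype V]

theorem TrafficEquations.unique {J : JacksonNetwork V} (he : ∀ y, 0 < J.exitProb y) {σ τ : V → ℝ}
    (hσ : J.TrafficEquations σ) (hτ : J.TrafficEquations τ) : σ = τ := by
  have hsub : ∀ x, σ x - τ x = ∑ y, (σ y - τ y) * J.routing y x := fun x => by
    rw [hσ x, hτ x, add_sub_add_left_eq_sub, ← Finset.sum_sub_distrib]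
    exact Finset.sum_congr rfl fun y _ => (sub_mul _ _ _).symm
  -- Routing contracts the `ℓ¹` norm of the difference, losing mass `exitProb y` at each `y`; no
  -- loss can occur, so the difference is zero.
  have hle : ∑ x, |σ x - τ x| ≤ ∑ y, |σ y - τ y| * (1 - J.exitProb y) := by
    simp only [← J.sum_routing, Finset.mul_sum]
    rw [Finset.sum_comm]
    refine Finset.sum_le_sum fun x _ => ?_
    rw [hsub x]
    refine (Finset.abs_sum_le_sum_abs _ _).trans_eq (Finset.sum_congr rfl fun y _ => ?_)
    rw [abs_mul, abs_of_nonneg (J.routing_nonneg y x)]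
  have hnonneg : ∀ y ∈ Finset.univ, 0 ≤ |σ y - τ y| * J.exitProb y := fun y _ =>
    mul_nonneg (abs_nonneg _) (he y).le
  have hzero : ∑ y, |σ y - τ y| * J.exitProb y = 0 := by
    simp only [mul_sub, mul_one, Finset.sum_sub_distrib] at hle
    exact le_antisymm (by linarith) (Finset.sum_nonneg hnonneg)
  ext x
  have := (Finset.sum_eq_zero_iff_of_nonneg hnonneg).1 hzero x (Finset.mem_univ x)
  simpa [(he x).ne', sub_eq_zero] using this

variable [DecidableEq V]

theorem Isotropic.sum_routing_left {J : JacksonNetwork V} {A : V → Finset V} {a : ℕ} {r : ℝ}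
    (hJ : J.Isotropic A) (hA : IsHomogeneousNeighborhood A a) (hr : ∀ y, J.exitProb y = r)
    (x : V) : ∑ y, J.routing y x = 1 - r := by
  have hrow : ∀ y, J.routing y x = if x ∈ A y then 1 / (a : ℝ) * (1 - r) else 0 := fun y => by
    split_ifs with h
    · rw [(hJ y).1 x h, hA.1, hr]
    · exact (hJ y).2 x h
  simp only [hrow]
  rw [← Finset.sum_filter, Finset.sum_const, hA.2 x, nsmul_eq_mul]
  -- Without neighbors nothing is forwarded, so the row sum gives `1 - r = 0` and both sides vanish.
  rcases Nat.eq_zero_or_pos a with rfl | ha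
  · have hempty : A x = ∅ := Finset.card_eq_zero.1 (hA.1 x)
    have h := J.sum_routing x
    rw [Finset.sum_eq_zero fun z _ => (hJ x).2 z (by simp [hempty]), hr] at h
    rw [← h]
    simp
  · field_simp

end JacksonNetwork

/-! ### The stability criterion on the periodic lattice. -/

theorem theorem1 (d L : ℕ) [NeZero L]
    (A : LatticeSite d L → Finset (LatticeSite d L)) (a : ℕ)
    (hA : IsHomogeneousNeighborhood A a)
    (lam rInf : ℝ) (hlam : 0 < lam) (hrInf : 0 < rInf)
    (J : JacksonNetwork (LatticeSite d L))
    (harrival : ∀ x, J.arrivalRate x = lam)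
    (hservice : ∀ y, J.serviceRate y = 1)
    (hisotropic : J.Isotropic A)
    (hhomogeneous : ∀ y, J.exitProb y = rInf) :
    -- the traffic equations have exactly one solution, the constant `lam / rInf`
    (∀ σ : LatticeSite d L → ℝ, J.TrafficEquations σ ↔ ∀ x, σ x = lam / rInf) ∧
    -- the network converges to a stable state, from all initial laws or from a given one,
    -- if and only if `lam / rInf < 1`
    (J.ConvergesToStableState ↔ lam / rInf < 1) ∧
    (∀ ν : Measure (LatticeSite d L → ℕ), IsProbabilityMeasure ν →
      ((∃ π : Measure (LatticeSite d L → ℕ), IsProbabilityMeasure π ∧ J.ConvergesInLaw ν π) ↔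
        lam / rInf < 1)) ∧
    -- in the stable state the queue length of each site is geometric, with mean `ρ / (1 - ρ)`
    (∀ ν π : Measure (LatticeSite d L → ℕ), IsProbabilityMeasure ν → IsProbabilityMeasure π →
      J.ConvergesInLaw ν π → ∀ x : LatticeSite d L,
        (∀ n : ℕ, π {q | q x = n} =
          ENNReal.ofReal ((1 - lam / rInf) * (lam / rInf) ^ n)) ∧
        Integrable (fun q : LatticeSite d L → ℕ => (q x : ℝ)) π ∧
        ∫ q, (q x : ℝ) ∂π = (lam / rInf) / (1 - lam / rInf)) := by
  set ρ := lam / rInf with hρ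
  have hρ0 : 0 < ρ := div_pos hlam hrInf
  have he : ∀ y, 0 < J.exitProb y := fun y => by
    rw [hhomogeneous]
    exact hrInf
  have harr : ∀ x, 0 < J.arrivalRate x := fun x => by
    rw [harrival]
    exact hlam
  have hrate : 0 < J.totalRate :=
    add_pos_of_pos_of_nonneg (Finset.sum_pos (fun x _ => harr x) Finset.univ_nonempty)
      (Finset.sum_nonneg fun y _ => J.serviceRate_nonneg y)
  have htraffic : J.TrafficEquations fun _ => ρ := fun x => by
    rw [← Finset.mul_sum, hisotropic.sum_routing_left hA hhomogeneous, harrival, hρ]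
    field_simp
    ring
  -- With unit service rate the throughput at a site is its busy probability. Uniqueness of the
  -- traffic equals it to `ρ`, and a positive idle probability makes it less than `1`.
  have hlt : ∀ π : Measure (LatticeSite d L → ℕ), IsProbabilityMeasure π → J.IsStationary π →
      ρ < 1 := by
    intro π _ hπ
    let x : LatticeSite d L := 0
    have hx := congrFun (hπ.trafficEquations.unique he htraffic) x
    simp only [hservice, one_mul] at hx
    have hidle := hπ.measure_eq_zero_ne_zero (x := x) (by rw [hservice]; exact one_pos) (he x)
    have hcompl : {q : LatticeSite d L → ℕ | 0 < q x} = {q | q x = 0}ᶜ := by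
      ext q
      simp [Nat.pos_iff_ne_zero]
    rw [hcompl, probReal_compl_eq_one_sub (Set.to_countable _).measurableSet] at hx
    have hpos : 0 < π.real {q | q x = 0} :=
      measureReal_nonneg.lt_of_ne' fun h => hidle ((measureReal_eq_zero_iff).1 h)
    linarith
  have hconv : ρ < 1 → ∃ p : unitInterval, (p : ℝ) = 1 - ρ ∧ p ≠ 0 ∧
      ∀ ν : Measure (LatticeSite d L → ℕ), IsProbabilityMeasure ν →
        J.ConvergesInLaw ν (productGeometric fun _ => p) := by
    intro h1
    -- The success probability is that of an idle site, `1 - ρ`; it differs from `1` because `ρ >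
    -- 0`, which gives the product law full support.
    have hp : (1 - ρ : ℝ) ∈ unitInterval := ⟨by linarith, by linarith⟩
    have hp0 : (⟨1 - ρ, hp⟩ : unitInterval) ≠ 0 := by
      rw [← unitInterval.coe_ne_zero]
      exact (sub_pos.2 h1).ne'
    have hp1 : (⟨1 - ρ, hp⟩ : unitInterval) ≠ 1 := by
      rw [← unitInterval.coe_ne_one]
      exact (sub_lt_self 1 hρ0).ne
    refine ⟨⟨1 - ρ, hp⟩, rfl, hp0, fun ν _ => ?_⟩
    refine (JacksonNetwork.isStationary_productGeometric (fun _ => hp0) ?_).convergesInLaw hrate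
      (productGeometric_singleton_ne_zero (fun _ => hp0) fun _ => hp1) harr ν
    simpa only [hservice, one_mul, sub_sub_cancel] using htraffic
  have hiff : ∀ ν : Measure (LatticeSite d L → ℕ), IsProbabilityMeasure ν →
      ((∃ π : Measure (LatticeSite d L → ℕ), IsProbabilityMeasure π ∧ J.ConvergesInLaw ν π) ↔
        ρ < 1) := by
    intro ν hν
    refine ⟨fun ⟨π, hπ, hc⟩ => hlt π hπ (hc.isStationary hrate), fun h => ?_⟩
    obtain ⟨p, -, -, hc⟩ := hconv h
    exact ⟨_, inferInstance, hc ν hν⟩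
  refine ⟨fun σ => ⟨fun hσ x => congrFun (hσ.unique he htraffic) x, fun hσ => ?_⟩,
    ⟨fun ⟨π, hπ, hc⟩ => ?_, fun h => ?_⟩, hiff, fun ν π hν hπ hc x => ?_⟩
  · rwa [show σ = fun _ => ρ from funext hσ]
  -- Any initial law would do; the empty network is chosen.
  · exact (hiff (Measure.dirac 0) inferInstance).1 ⟨π, hπ, hc _ inferInstance⟩
  · obtain ⟨p, -, -, hc⟩ := hconv h
    exact ⟨_, inferInstance, hc⟩
  · obtain ⟨p, hp, hp0, hc'⟩ := hconv ((hiff ν hν).1 ⟨π, hπ, hc⟩)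
    rw [hc.unique (hc' ν hν)]
    have h1p : (1 - p : ℝ) = ρ := by rw [hp, sub_sub_cancel]
    refine ⟨fun n => ?_, integrable_eval_productGeometric hp0, ?_⟩
    · rw [productGeometric_setOf_eq hp0, h1p, hp, mul_comm]
    · rw [integral_eval_productGeometric hp0, h1p, hp]
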